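/- Let $\Gamma$ be a finite, simple, connected graph with vertex set $X$, path-length distance $\partial$ and diameter $D\ge 3$. Write $\Gamma_i(x)$ for the set of vertices at distance $i$ from $x$. Assume that $\Gamma$ is distance-regular, i.e. for all $0\le h,i,j\le D$ the number $p^h_{ij}=|\Gamma_i(x)\cap\Gamma_j(y)|$ is the same for all $x,y\in X$ with $\partial(x,y)=h$, and put $c_i=p^i_{1,i-1}$ $(1\le i\le D)$, $a_i=p^i_{1,i}$ $(0\le i\le D)$, $b_i=p^i_{1,i+1}$ $(0\le i\le D-1)$; let $k=b_0$ be the valency of $\Gamma$. Assume that: 1. $\Gamma$ has negative type: there are real numbers $b,\alpha,\beta$ with $b<-1$ such that, with ${j\brack 1}=1+b+\cdots+b^{j-1}$, $$c_i={i\brack 1}\Big(1+\alpha{i-1\brack 1}\Big)\ (1\le i\le D),\qquad b_i=\Big({D\brack 1}-{i\brack 1}\Big)\Big(\beta-\alpha{i\brack 1}\Big)\ (0\le i\le D-1);$$ 2. $a_1\neq 0$; 3. $\Gamma$ is not a near polygon, where $\Gamma$ is called a near polygon if $a_i=a_1c_i$ for $1\le i\le D-1$ and there are no vertices $u,v,w,z$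 with $u,v,w$ mutually adjacent, $\partial(u,z)=2$ and $\partial(v,z)=\partial(w,z)=1$. Fix $x\in X$ and let $\Delta=\Delta(x)$ be the subgraph of $\Gamma$ induced on the set of neighbours of $x$. Then: (i) $\Delta$ is a disjoint union of $k/(a_1+1)$ cliques, each consisting of $a_1+1$ vertices (in particular $a_1+1$ divides $k$), with no edges between different cliques. (ii) The eigenvalues of the adjacency matrix of $\Delta$ (the local eigenvalues of $\Gamma$) are precisely $a_1$, with multiplicity $k/(a_1+1)$, and $-1$, with multiplicity $ka_1/(a_1+1)$. -/

import Mathlib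

namespace DistReg

variable {V : Type*} [Fintype V]

/-- `|Γ_i(x) ∩ Γ_j(y)|`: the number of vertices at distance `i` from `x` and `j` from `y`. -/
noncomputable def sphereInterCard (G : SimpleGraph V) (i j : ℕ) (x y : V) : ℕ :=
  (Finset.univ.filter fun z => G.dist x z = i ∧ G.dist y z = j).card

/-- A connected graph is distance-regular if `|Γ_i(x) ∩ Γ_j(y)|` depends only on `i`, `j` and
the distance of `x` and `y`. -/
def IsDistanceRegular (G : SimpleGraph V) : Prop :=
  G.Connected ∧ ∀ h i j : ℕ, h ≤ G.diam → i ≤ G.diam → j ≤ G.diam →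
    ∀ x y x' y' : V, G.dist x y = h → G.dist x' y' = h →
      sphereInterCard G i j x y = sphereInterCard G i j x' y'

open Classical in
/-- The intersection number `p^h_{ij}`: the common value of `|Γ_i(x) ∩ Γ_j(y)|` over the pairs
`x, y` at distance `h`, evaluated at a chosen pair (and `0` if there is no such pair). -/
noncomputable def intersectionNumber (G : SimpleGraph V) (h i j : ℕ) : ℕ :=
  if hp : ∃ q : V × V, G.dist q.1 q.2 = h then
    sphereInterCard G i j hp.choose.1 hp.choose.2
  else 0

theorem IsDistanceRegular.intersectionNumber_eq {G : SimpleGraph V} (hG : IsDistanceRegular G)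
    {h i j : ℕ} (hh : h ≤ G.diam) (hi : i ≤ G.diam) (hj : j ≤ G.diam) {x y : V}
    (hxy : G.dist x y = h) : intersectionNumber G h i j = sphereInterCard G i j x y := by
  have hp : ∃ q : V × V, G.dist q.1 q.2 = h := ⟨(x, y), hxy⟩
  rw [intersectionNumber, dif_pos hp]
  exact hG.2 h i j hh hi hj _ _ _ _ hp.choose_spec hxy

/-- `a_i = p^i_{1,i}`. -/
noncomputable def aNum (G : SimpleGraph V) (i : ℕ) : ℕ := intersectionNumber G i 1 i

/-- `b_i = p^i_{1,i+1}` for `i < D`, and `b_D = 0`. -/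
noncomputable def bNum (G : SimpleGraph V) (i : ℕ) : ℕ :=
  if i < G.diam then intersectionNumber G i 1 (i + 1) else 0

/-- `c_i = p^i_{1,i-1}` for `1 ≤ i`, and `c_0 = 0`. -/
noncomputable def cNum (G : SimpleGraph V) : ℕ → ℕ
  | 0 => 0
  | i + 1 => intersectionNumber G (i + 1) 1 i

/-- The number `1 + b + ⋯ + b^(j-1)`. -/
def bracket (b : ℝ) (j : ℕ) : ℝ := ∑ l ∈ Finset.range j, b ^ l

/-- `G` has classical parameters `(D, b, α, β)`, where `D` is the diameter of `G`. -/
def HasClassicalParameters (G : SimpleGraph V) (D : ℕ) (b α β : ℝ) : Prop :=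
  G.diam = D ∧
  (∀ i : ℕ, 1 ≤ i → i ≤ D →
    (cNum G i : ℝ) = bracket b i * (1 + α * bracket b (i - 1))) ∧
  (∀ i : ℕ, i < D →
    (bNum G i : ℝ) = (bracket b D - bracket b i) * (β - α * bracket b i))

/-- `uvwz` is a kite of length `i` (used for `2 ≤ i`). -/
def IsKite (G : SimpleGraph V) (i : ℕ) (u v w z : V) : Prop :=
  G.Adj u v ∧ G.Adj u w ∧ G.Adj v w ∧
    G.dist u z = i ∧ G.dist v z = i - 1 ∧ G.dist w z = i - 1

/-- Near polygons (among distance-regular graphs): `a_i = a_1 c_i` for `1 ≤ i ≤ D - 1`, and there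
is no kite of length `2`. -/
def IsNearPolygon (G : SimpleGraph V) : Prop :=
  (∀ i : ℕ, 1 ≤ i → i < G.diam → aNum G i = aNum G 1 * cNum G i) ∧
    ¬ ∃ u v w z : V, IsKite G 2 u v w z

/-- `H` is the disjoint union of `m` cliques with `s` vertices each: the vertex set is partitioned
into `m` parts of size `s`, and two distinct vertices are adjacent iff they share a part. -/
def IsDisjointUnionOfCliques {W : Type*} [Fintype W] [DecidableEq W] (H : SimpleGraph W)
    (m s : ℕ) : Prop :=
  ∃ P : Finpartition (Finset.univ : Finset W),
    P.parts.card = m ∧ (∀ C ∈ P.parts, C.card = s) ∧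
      ∀ y z : W, H.Adj y z ↔ y ≠ z ∧ ∃ C ∈ P.parts, y ∈ C ∧ z ∈ C

/-- The local graph `Δ(x)`: the subgraph of `G` induced on the neighbours of `x`. -/
abbrev localGraph (G : SimpleGraph V) (x : V) : SimpleGraph (G.neighborSet x) :=
  G.induce (G.neighborSet x)

/-- The adjacency matrix of `Δ(x)`, acting on column vectors. -/
noncomputable def localAdj [DecidableEq V] (G : SimpleGraph V) [DecidableRel G.Adj] (x : V) :
    Module.End ℂ (G.neighborSet x → ℂ) :=
  Matrix.toLin' ((localGraph G x).adjMatrix ℂ)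

end DistReg

/-!
Let `q = b⁻¹`. For classical parameters, multiplication by the adjacency matrix `A` preserves the
space of matrices `p (q ^ d(x, y))` with `p` a polynomial of degree less than `n`, and acts on the
successive quotients by scalars `θ n` of the form `e + c b ^ n + d q ^ n`; the columns of these
matrices thus give a flag whose layers consist of eigenvectors of `A`. Fix a vertex `y` and let `S`
be the diagonal matrix with entries `q ^ d(y, w)`. By the argument of Cameron, Goethals and Seidel
for the Krein condition, `S` raises the flag by at most one step, so it is block tridiagonal with
respect to the layers, and the three-term relation satisfied by the `θ n` says that `A` commutes
with `A²S - (b + b⁻¹)ASA + SA² - γ(AS + SA) - ρS` for suitable `γ` and `ρ`.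

The entry of this relation at two vertices `u`, `z` at distance three is the balanced set condition
of Terwilliger. With `y = v` a neighbour of `u` at distance two from `z`, it becomes `b * m = t`,
where `m` is the number of kites of length three on `u`, `v`, `z` and `t` is another cardinality.
As `b < 0`, there are no kites of length three; a kite of length two would extend to one of length
three. Hence each local graph is a cluster graph, regular of degree `a₁`, and its spectrum follows
from `(A - a₁)(A + 1) = 0` and `tr A = 0`.
-/

namespace DistReg

open Finset Polynomial
open scoped Matrix

section Counting

variable {V : Type*} {G : SimpleGraph V}

theorem exists_adj_dist_eq_of_dist_eq_succ {x z : V} {h : ℕ} (hG : G.Connected)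
    (hxz : G.dist x z = h + 1) : ∃ w, G.Adj x w ∧ G.dist w z = h := by
  obtain ⟨p, hp⟩ := hG.exists_walk_length_eq_dist x z
  cases p with
  | nil => simp at hxz
  | @cons _ w _ hadj p =>
    refine ⟨w, hadj, ?_⟩
    have hle := SimpleGraph.dist_le p
    have htri := hG.dist_triangle (u := x) (v := w) (w := z)
    have hxw := SimpleGraph.dist_eq_one_iff_adj.2 hadj
    rw [SimpleGraph.Walk.length_cons] at hp
    omega

theorem dist_eq_or_of_adj {x w : V} (hG : G.Connected) (hxw : G.Adj x w) (z : V) :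
    G.dist w z + 1 = G.dist x z ∨ G.dist w z = G.dist x z ∨ G.dist w z = G.dist x z + 1 := by
  have hdist := SimpleGraph.dist_eq_one_iff_adj.2 hxw
  have hdist' := SimpleGraph.dist_eq_one_iff_adj.2 hxw.symm
  have htri := hG.dist_triangle (u := x) (v := w) (w := z)
  have htri' := hG.dist_triangle (u := w) (v := x) (w := z)
  omega

variable [Fintype V]

theorem IsDistanceRegular.dist_le_diam (hG : IsDistanceRegular G) (x y : V) :
    G.dist x y ≤ G.diam := by
  have : Nonempty V := ⟨x⟩
  exact SimpleGraph.dist_le_diam (SimpleGraph.connected_iff_ediam_ne_top.1 hG.1)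

theorem IsDistanceRegular.exists_dist_eq (hG : IsDistanceRegular G) {i : ℕ} (hi : i ≤ G.diam) :
    ∃ x z : V, G.dist x z = i := by
  have := hG.1.nonempty
  induction hi using Nat.decreasingInduction with
  | self => exact SimpleGraph.exists_dist_eq_diam
  | of_succ _ _ ih =>
    obtain ⟨x, z, hxz⟩ := ih
    obtain ⟨w, -, hw⟩ := exists_adj_dist_eq_of_dist_eq_succ hG.1 hxz
    exact ⟨w, z, hw⟩

section Neighbors

variable [DecidableRel G.Adj]

theorem IsDistanceRegular.card_neighbor_closer (hG : IsDistanceRegular G) (x z : V) :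
    #{w ∈ G.neighborFinset x | G.dist w z + 1 = G.dist x z} = cNum G (G.dist x z) := by
  rcases h : G.dist x z with _ | i
  · simp [cNum]
  · have hle := hG.dist_le_diam x z
    rw [cNum, hG.intersectionNumber_eq (by omega) (by omega) (by omega) h, sphereInterCard]
    congr 1
    ext w
    simp [SimpleGraph.dist_eq_one_iff_adj, SimpleGraph.dist_comm (u := z)]

theorem IsDistanceRegular.card_neighbor_farther (hG : IsDistanceRegular G) (x z : V) :
    #{w ∈ G.neighborFinset x | G.dist w z = G.dist x z + 1} = bNum G (G.dist x z) := by
  rw [bNum]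
  split_ifs with h
  · rw [hG.intersectionNumber_eq (by omega) (by omega) (by omega) rfl, sphereInterCard]
    congr 1
    ext w
    simp [SimpleGraph.dist_eq_one_iff_adj, SimpleGraph.dist_comm (u := z)]
  · rw [Finset.card_eq_zero, Finset.filter_eq_empty_iff]
    intro w _ hw
    have := hG.dist_le_diam w z
    omega

theorem IsDistanceRegular.card_common_neighbor (hG : IsDistanceRegular G) {x y : V}
    (h : G.Adj x y) : #{w ∈ G.neighborFinset x | G.Adj y w} = aNum G 1 := by
  have hxy := SimpleGraph.dist_eq_one_iff_adj.2 h
  have hD : 1 ≤ G.diam := hxy ▸ hG.dist_le_diam x y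
  rw [aNum, hG.intersectionNumber_eq hD hD hD hxy, sphereInterCard]
  congr 1
  ext w
  simp [SimpleGraph.dist_eq_one_iff_adj]

theorem IsDistanceRegular.degree_eq (hG : IsDistanceRegular G) (x : V) :
    G.degree x = bNum G 0 := by
  rw [← SimpleGraph.card_neighborFinset_eq_degree, ← SimpleGraph.dist_self (G := G) (v := x),
    ← hG.card_neighbor_farther, Finset.filter_true_of_mem]
  intro w hw
  rw [SimpleGraph.dist_self, SimpleGraph.dist_eq_one_iff_adj.2]
  exact ((G.mem_neighborFinset x w).1 hw).symm

end Neighbors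

theorem IsDistanceRegular.cNum_ne_zero (hG : IsDistanceRegular G) {i : ℕ} (h1 : 1 ≤ i)
    (hi : i ≤ G.diam) : cNum G i ≠ 0 := by
  classical
  obtain ⟨x, z, rfl⟩ := hG.exists_dist_eq hi
  obtain ⟨w, hw, hwz⟩ :=
    exists_adj_dist_eq_of_dist_eq_succ hG.1 (Nat.sub_add_cancel h1).symm
  rw [← hG.card_neighbor_closer, Finset.card_ne_zero]
  exact ⟨w, by simp [hw]; omega⟩

theorem IsDistanceRegular.exists_farther_neighbor (hG : IsDistanceRegular G) {x z : V}
    (h : G.dist x z < G.diam) : ∃ w, G.Adj x w ∧ G.dist w z = G.dist x z + 1 := by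
  classical
  have hb : bNum G (G.dist x z) ≠ 0 := by
    obtain ⟨u, v, huv⟩ := hG.exists_dist_eq h
    obtain ⟨w, hw, hwv⟩ := exists_adj_dist_eq_of_dist_eq_succ hG.1 huv
    rw [← hwv, ← hG.card_neighbor_farther, Finset.card_ne_zero]
    exact ⟨u, by simp [hw.symm]; omega⟩
  rw [← hG.card_neighbor_farther, Finset.card_ne_zero] at hb
  obtain ⟨w, hw⟩ := hb
  exact ⟨w, by simpa using hw⟩

theorem IsDistanceRegular.sum_neighbor [DecidableRel G.Adj] (hG : IsDistanceRegular G)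
    (f : ℕ → ℝ) (x z : V) :
    ∑ w ∈ G.neighborFinset x, f (G.dist w z) =
      cNum G (G.dist x z) * f (G.dist x z - 1) + bNum G (G.dist x z) * f (G.dist x z + 1) +
        (bNum G 0 - cNum G (G.dist x z) - bNum G (G.dist x z)) * f (G.dist x z) := by
  have hpt : ∀ w ∈ G.neighborFinset x, f (G.dist w z) = f (G.dist x z) +
      ((if G.dist w z + 1 = G.dist x z then f (G.dist x z - 1) - f (G.dist x z) else 0) +
      (if G.dist w z = G.dist x z + 1 then f (G.dist x z + 1) - f (G.dist x z) else 0)) := by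
    intro w hw
    rcases dist_eq_or_of_adj hG.1 ((G.mem_neighborFinset x w).1 hw) z with h | h | h
    · rw [if_pos h, if_neg (by omega), ← h]
      simp
    · simp [h]
    · simp [h, Nat.add_assoc]
  rw [Finset.sum_congr rfl hpt, Finset.sum_add_distrib, Finset.sum_add_distrib,
    ← Finset.sum_filter, ← Finset.sum_filter, Finset.sum_const, Finset.sum_const,
    Finset.sum_const, hG.card_neighbor_closer, hG.card_neighbor_farther,
    SimpleGraph.card_neighborFinset_eq_degree, hG.degree_eq]
  simp only [nsmul_eq_mul]
  ring

end Counting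

section BoseMesner

variable {V : Type*} (G : SimpleGraph V)

/-- The matrix whose `(x, y)` entry is `f` of the distance of `x` and `y`. If `G` is
distance-regular, these matrices make up its Bose–Mesner algebra. -/
noncomputable def distMatrix (f : ℕ → ℝ) : Matrix V V ℝ := Matrix.of fun x y => f (G.dist x y)

@[simp] theorem distMatrix_apply (f : ℕ → ℝ) (x y : V) :
    distMatrix G f x y = f (G.dist x y) := rfl

variable {G}

theorem adjMatrix_eq_distMatrix [DecidableRel G.Adj] :
    G.adjMatrix ℝ = distMatrix G (Pi.single 1 1) := by
  ext x y
  simp [Pi.single_apply, SimpleGraph.dist_eq_one_iff_adj, SimpleGraph.adjMatrix_apply]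

variable [Fintype V] [DecidableRel G.Adj]

theorem IsDistanceRegular.adjMatrix_mul_distMatrix (hG : IsDistanceRegular G) (f : ℕ → ℝ) :
    G.adjMatrix ℝ * distMatrix G f = distMatrix G fun h =>
      cNum G h * f (h - 1) + bNum G h * f (h + 1) + (bNum G 0 - cNum G h - bNum G h) * f h := by
  ext x z
  rw [SimpleGraph.adjMatrix_mul_apply]
  exact hG.sum_neighbor f x z

variable [DecidableEq V]

theorem IsDistanceRegular.distMatrix_mem_adjoin_of_support_le (hG : IsDistanceRegular G) (n : ℕ)
    {f : ℕ → ℝ} (hf : ∀ h, n < h → h ≤ G.diam → f h = 0) :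
    distMatrix G f ∈ Algebra.adjoin ℝ {G.adjMatrix ℝ} := by
  induction n generalizing f with
  | zero =>
    have hf0 : distMatrix G f = f 0 • 1 := by
      ext x y
      rcases eq_or_ne x y with rfl | hxy
      · simp
      · simp [hxy, hf _ (hG.1.pos_dist_of_ne hxy) (hG.dist_le_diam x y)]
    exact hf0 ▸ Subalgebra.smul_mem _ (one_mem _) _
  | succ n ih =>
    -- The support of `g` ends at `n + 1`, with the value `c (n + 1) ≠ 0` there, so that a multiple
    -- of `g` clears the top value of `f`.
    set e : ℕ → ℝ := Pi.single n 1 with he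
    set g : ℕ → ℝ := fun h =>
      cNum G h * e (h - 1) + bNum G h * e (h + 1) + (bNum G 0 - cNum G h - bNum G h) * e h with hg
    have hAe : G.adjMatrix ℝ * distMatrix G e = distMatrix G g := hG.adjMatrix_mul_distMatrix e
    have he_mem : distMatrix G e ∈ Algebra.adjoin ℝ {G.adjMatrix ℝ} :=
      ih fun h hh _ => Pi.single_eq_of_ne (by omega) _
    have hrest : distMatrix G (f - (f (n + 1) / cNum G (n + 1)) • g) ∈
        Algebra.adjoin ℝ {G.adjMatrix ℝ} := by
      refine ih fun h hh hhD => ?_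
      rcases (Nat.succ_le_of_lt hh).eq_or_lt with rfl | hlt
      · have hc : (cNum G (n + 1) : ℝ) ≠ 0 := by exact_mod_cast hG.cNum_ne_zero (by omega) hhD
        have hne : n + 1 + 1 ≠ n := by omega
        simp [hg, he, Pi.single_apply, hne, hc]
      · have hne : h - 1 ≠ n ∧ h + 1 ≠ n ∧ h ≠ n := by omega
        simp [hg, he, Pi.single_apply, hne, hf h hlt hhD]
    have hsplit : distMatrix G f = distMatrix G (f - (f (n + 1) / cNum G (n + 1)) • g) +
        (f (n + 1) / cNum G (n + 1)) • (G.adjMatrix ℝ * distMatrix G e) := by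
      rw [hAe]
      ext x y
      simp
    exact hsplit ▸ add_mem hrest (Subalgebra.smul_mem _
      (mul_mem (Algebra.self_mem_adjoin_singleton ℝ _) he_mem) _)

theorem IsDistanceRegular.distMatrix_mem_adjoin (hG : IsDistanceRegular G) (f : ℕ → ℝ) :
    distMatrix G f ∈ Algebra.adjoin ℝ {G.adjMatrix ℝ} :=
  hG.distMatrix_mem_adjoin_of_support_le G.diam fun _ hlt hle => absurd hle hlt.not_ge

end BoseMesner

section Tridiagonal

variable {E : Type*} [NormedAddCommGroup E] [InnerProductSpace ℝ E] {W : ℕ → Submodule ℝ E}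

/-- The orthogonal complement of `W n` in `W (n + 1)`, for a flag `W`. If a symmetric operator acts
on each quotient `W (n + 1) / W n` as a scalar, the layers consist of eigenvectors. -/
noncomputable def layer (W : ℕ → Submodule ℝ E) (n : ℕ) : Submodule ℝ E := (W n)ᗮ ⊓ W (n + 1)

theorem inner_eq_zero_of_mem_layer (hW : Monotone W) {m n : ℕ} (hmn : m ≤ n) {v w : E}
    (hv : v ∈ W m) (hw : w ∈ layer W n) : inner ℝ v w = 0 :=
  (Submodule.mem_orthogonal _ _).1 hw.1 v (hW hmn hv)

variable {T S : Module.End ℝ E} {θ : ℕ → ℝ}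

theorem apply_eq_smul_of_mem_layer (hT : T.IsSymmetric) (hW : Monotone W) (hW0 : W 0 = ⊥)
    (hTW : ∀ n, ∀ v ∈ W (n + 1), T v - θ n • v ∈ W n) {n : ℕ} {v : E} (hv : v ∈ layer W n) :
    T v = θ n • v := by
  have hTmem : ∀ u ∈ W n, T u ∈ W n := by
    rcases n with _ | n
    · simp [hW0]
    · intro u hu
      simpa using add_mem (hW n.le_succ (hTW n u hu)) (Submodule.smul_mem _ (θ n) hu)
  have hmem : T v - θ n • v ∈ W n := hTW n v hv.2
  rw [← sub_eq_zero, ← inner_self_eq_zero (𝕜 := ℝ), inner_sub_right, ← hT, inner_smul_right,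
    inner_eq_zero_of_mem_layer hW le_rfl (hTmem _ hmem) hv,
    inner_eq_zero_of_mem_layer hW le_rfl hmem hv, mul_zero, sub_zero]

theorem inner_apply_eq_zero_of_mem_layer (hS : S.IsSymmetric) (hW : Monotone W)
    (hSW : ∀ n, ∀ v ∈ W n, S v ∈ W (n + 1)) {i j : ℕ} (hij : i + 1 < j ∨ j + 1 < i) {v w : E}
    (hv : v ∈ layer W i) (hw : w ∈ layer W j) : inner ℝ v (S w) = 0 := by
  rcases hij with h | h
  · rw [← hS]
    exact inner_eq_zero_of_mem_layer hW h (hSW _ v hv.2) hw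
  · rw [real_inner_comm]
    exact inner_eq_zero_of_mem_layer hW h (hSW _ w hw.2) hv

variable [FiniteDimensional ℝ E] {N : ℕ}

theorem eq_top_of_layer_le (hW : Monotone W) (hW0 : W 0 = ⊥) (hWN : W N = ⊤)
    {K : Submodule ℝ E} (hK : ∀ n, layer W n ≤ K) : K = ⊤ := by
  have hle (n : ℕ) : W n ≤ K := by
    induction n with
    | zero => simp [hW0]
    | succ n ih =>
      rw [← Submodule.sup_orthogonal_inf_of_hasOrthogonalProjection (hW n.le_succ)]
      exact sup_le ih (hK n)
  exact top_le_iff.1 (hWN ▸ hle N)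

theorem eq_zero_of_inner_layer (hW : Monotone W) (hW0 : W 0 = ⊥) (hWN : W N = ⊤)
    (h : ∀ i j, ∀ v ∈ layer W i, ∀ w ∈ layer W j, inner ℝ v (T w) = 0) : T = 0 := by
  refine LinearMap.ker_eq_top.1 (eq_top_of_layer_le hW hW0 hWN fun j w hw => ?_)
  have horth : (ℝ ∙ T w)ᗮ = ⊤ := eq_top_of_layer_le hW hW0 hWN fun i v hv =>
    Submodule.mem_orthogonal_singleton_iff_inner_left.2 (h i j v hv w hw)
  rwa [Submodule.orthogonal_eq_top_iff, Submodule.span_singleton_eq_bot] at horth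

theorem commute_tridiagonal (hT : T.IsSymmetric) (hS : S.IsSymmetric) (hW : Monotone W)
    (hW0 : W 0 = ⊥) (hWN : W N = ⊤) (hTW : ∀ n, ∀ v ∈ W (n + 1), T v - θ n • v ∈ W n)
    (hSW : ∀ n, ∀ v ∈ W n, S v ∈ W (n + 1)) {B γ ρ : ℝ}
    (hθ : ∀ n, θ n ^ 2 - B * θ n * θ (n + 1) + θ (n + 1) ^ 2 - γ * (θ n + θ (n + 1)) - ρ = 0) :
    Commute T (T * T * S - B • (T * S * T) + S * T * T - γ • (T * S + S * T) - ρ • S) := by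
  refine sub_eq_zero.1 (eq_zero_of_inner_layer hW hW0 hWN fun i j v hv w hw => ?_)
  have hTw : T w = θ j • w := apply_eq_smul_of_mem_layer hT hW hW0 hTW hw
  have hTv (u : E) : inner ℝ v (T u) = θ i * inner ℝ v u := by
    rw [← hT, apply_eq_smul_of_mem_layer hT hW hW0 hTW hv, real_inner_smul_left]
  have hfactor : inner ℝ v ((T * (T * T * S - B • (T * S * T) + S * T * T - γ • (T * S + S * T)
      - ρ • S) - (T * T * S - B • (T * S * T) + S * T * T - γ • (T * S + S * T) - ρ • S) * T) w) =
      (θ i - θ j) * (θ i ^ 2 - B * θ i * θ j + θ j ^ 2 - γ * (θ i + θ j) - ρ) *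
        inner ℝ v (S w) := by
    simp only [LinearMap.sub_apply, LinearMap.add_apply, LinearMap.smul_apply,
      Module.End.mul_apply, inner_sub_right, inner_add_right, inner_smul_right, hTv, hTw, map_smul]
    ring
  -- The first two factors vanish if `|i - j| ≤ 1`, and the third one vanishes otherwise.
  rw [hfactor]
  rcases lt_trichotomy (i + 1) j with h | rfl | h
  · rw [inner_apply_eq_zero_of_mem_layer hS hW hSW (.inl h) hv hw, mul_zero]
  · rw [hθ i]
    ring
  · rcases lt_trichotomy i (j + 1) with h' | rfl | h'
    · obtain rfl : i = j := by omega
      simp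
    · linear_combination (θ (j + 1) - θ j) * inner ℝ v (S w) * hθ j
    · rw [inner_apply_eq_zero_of_mem_layer hS hW hSW (.inr h') hv hw, mul_zero]

theorem geometric_three_term {b : ℝ} (hb : b ≠ 0) (e c d : ℝ) {θ : ℕ → ℝ}
    (hθ : ∀ n, θ n = e + c * b ^ n + d * b⁻¹ ^ n) (n : ℕ) :
    θ n ^ 2 - (b + b⁻¹) * θ n * θ (n + 1) + θ (n + 1) ^ 2
      - e * (2 - (b + b⁻¹)) * (θ n + θ (n + 1))
      - (c * d * (4 - (b + b⁻¹) ^ 2) - e ^ 2 * (2 - (b + b⁻¹))) = 0 := by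
  have h1 : b ^ n * b⁻¹ ^ n = 1 := by rw [← mul_pow, mul_inv_cancel₀ hb, one_pow]
  have h2 : b * b⁻¹ = 1 := mul_inv_cancel₀ hb
  rw [hθ, hθ, pow_succ, pow_succ]
  linear_combination (-c ^ 2 * (b ^ n) ^ 2 - d ^ 2 * (b⁻¹ ^ n) ^ 2 + 2 * c * d) * h2 +
    c * d * (2 + 2 * b * b⁻¹ - (b + b⁻¹) ^ 2) * h1

end Tridiagonal

section ColumnSpan

variable {V : Type*}

/-- The space spanned by the columns of the matrices in `P`; for the span of some primitive
idempotents of a Bose–Mesner algebra, this is the sum of the corresponding eigenspaces. -/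
def columnSpan (P : Submodule ℝ (Matrix V V ℝ)) : Submodule ℝ (EuclideanSpace ℝ V) :=
  Submodule.span ℝ {v | ∃ M ∈ P, ∃ z, v = WithLp.toLp 2 (M.col z)}

variable {P Q : Submodule ℝ (Matrix V V ℝ)}

theorem toLp_col_mem_columnSpan {M : Matrix V V ℝ} (hM : M ∈ P) (z : V) :
    WithLp.toLp 2 (M.col z) ∈ columnSpan P :=
  Submodule.subset_span ⟨M, hM, z, rfl⟩

theorem columnSpan_le {K : Submodule ℝ (EuclideanSpace ℝ V)}
    (h : ∀ M ∈ P, ∀ z, WithLp.toLp 2 (M.col z) ∈ K) : columnSpan P ≤ K :=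
  Submodule.span_le.2 <| by
    rintro _ ⟨M, hM, z, rfl⟩
    exact h M hM z

theorem columnSpan_mono (h : P ≤ Q) : columnSpan P ≤ columnSpan Q :=
  columnSpan_le fun _ hM z => toLp_col_mem_columnSpan (h hM) z

theorem columnSpan_bot : columnSpan (⊥ : Submodule ℝ (Matrix V V ℝ)) = ⊥ :=
  le_bot_iff.1 <| columnSpan_le <| by
    rintro M rfl z
    rfl

theorem columnSpan_eq_top [Finite V] [DecidableEq V] (h : 1 ∈ P) : columnSpan P = ⊤ := by
  have := Fintype.ofFinite V
  rw [eq_top_iff, ← (EuclideanSpace.basisFun V ℝ).toBasis.span_eq, Submodule.span_le]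
  rintro _ ⟨z, rfl⟩
  have hz : (EuclideanSpace.basisFun V ℝ).toBasis z =
      WithLp.toLp 2 ((1 : Matrix V V ℝ).col z) := by
    ext w
    simp [Matrix.one_apply]
  exact hz ▸ toLp_col_mem_columnSpan h z

variable [Fintype V]

theorem toLpLin_sub_smul_mem_columnSpan [DecidableEq V] {A : Matrix V V ℝ}
    {c : ℝ} (h : ∀ M ∈ P, A * M - c • M ∈ Q) {v : EuclideanSpace ℝ V} (hv : v ∈ columnSpan P) :
    Matrix.toLpLinAlgEquiv 2 A v - c • v ∈ columnSpan Q := by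
  suffices columnSpan P ≤
      (columnSpan Q).comap (Matrix.toLpLinAlgEquiv 2 A - c • (1 : Module.End ℝ _)) from this hv
  exact columnSpan_le fun M hM z => toLp_col_mem_columnSpan (h M hM) z

theorem toLp_row_mul_col_mem {M N : Matrix V V ℝ} {K : Submodule ℝ (EuclideanSpace ℝ V)}
    (h : ∀ z, WithLp.toLp 2 (((M * Mᵀ) ⊙ (Nᵀ * N)).col z) ∈ K) (y z : V) :
    WithLp.toLp 2 (N.row y * M.col z) ∈ K := by
  classical
  rw [← Submodule.orthogonal_orthogonal K, Submodule.mem_orthogonal]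
  intro g hg
  have hgK : g.ofLp ᵥ* ((M * Mᵀ) ⊙ (Nᵀ * N)) = 0 := by
    ext w
    simpa [PiLp.inner_apply, Matrix.vecMul, dotProduct, mul_comm] using
      (Submodule.mem_orthogonal _ _).1 hg _ (h w)
  -- The argument of Cameron, Goethals and Seidel for the vanishing of Krein parameters:
  -- `‖N * diagonal g * M‖ ^ 2 = gᵀ * ((M * Mᵀ) ⊙ (Nᵀ * N)) * g`.
  have hzero : N * Matrix.diagonal g.ofLp * M = 0 := by
    rw [← Matrix.trace_mul_conjTranspose_self_eq_zero_iff,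
      Matrix.conjTranspose_eq_transpose_of_trivial]
    calc
      _ = Matrix.trace (Matrix.diagonal g.ofLp * (M * Mᵀ) *
            (Nᵀ * N * Matrix.diagonal g.ofLp)ᵀ) := by
          rw [mul_assoc, mul_assoc, Matrix.trace_mul_comm]
          simp only [Matrix.transpose_mul, Matrix.transpose_transpose, Matrix.diagonal_transpose,
            mul_assoc]
      _ = 0 := by
          rw [← Matrix.dotProduct_vecMul_hadamard, hgK, zero_dotProduct]
  have hyz := congrFun (congrFun hzero y) z
  rw [Matrix.mul_apply] at hyz
  simp only [Matrix.mul_diagonal, Matrix.zero_apply] at hyz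
  rw [← hyz, PiLp.inner_apply]
  refine Finset.sum_congr rfl fun u _ => ?_
  simp
  ring

end ColumnSpan

section PolyMatrix

variable {V : Type*} (G : SimpleGraph V)

/-- The matrix with entries `p (q ^ d(x, y))`, as a linear function of the polynomial `p`. -/
noncomputable def polyMatrix (q : ℝ) : ℝ[X] →ₗ[ℝ] Matrix V V ℝ where
  toFun p := distMatrix G fun h => p.eval (q ^ h)
  map_add' p r := by ext; simp
  map_smul' c p := by ext; simp

@[simp] theorem polyMatrix_apply (q : ℝ) (p : ℝ[X]) (x y : V) :
    polyMatrix G q p x y = p.eval (q ^ G.dist x y) := rfl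

/-- The matrices `polyMatrix G q p` with `p` of degree less than `n`. For a `Q`-polynomial graph
whose dual eigenvalues are affine functions of `q ^ h`, this is the span of the first `n` primitive
idempotents. -/
noncomputable def polyMatrices (q : ℝ) (n : ℕ) : Submodule ℝ (Matrix V V ℝ) :=
  (degreeLT ℝ n).map (polyMatrix G q)

variable {G} {q : ℝ}

theorem polyMatrices_zero : polyMatrices G q 0 = ⊥ := by
  refine le_bot_iff.1 ?_
  rintro _ ⟨p, hp, rfl⟩
  obtain rfl : p = 0 := by simpa [mem_degreeLT] using hp
  simp

theorem polyMatrices_mono : Monotone (polyMatrices G q) :=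
  fun _ _ h => Submodule.map_mono (degreeLT_mono h)

theorem transpose_of_mem_polyMatrices {n : ℕ} {M : Matrix V V ℝ} (hM : M ∈ polyMatrices G q n) :
    Mᵀ = M := by
  obtain ⟨p, -, rfl⟩ := hM
  ext x y
  simp [SimpleGraph.dist_comm]

theorem hadamard_mem_polyMatrices {m n : ℕ} {M N : Matrix V V ℝ} (hM : M ∈ polyMatrices G q m)
    (hN : N ∈ polyMatrices G q (n + 1)) : M ⊙ N ∈ polyMatrices G q (m + n) := by
  obtain ⟨p, hp, rfl⟩ := hM
  obtain ⟨r, hr, rfl⟩ := hN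
  refine ⟨p * r, ?_, ?_⟩
  · rcases eq_or_ne p 0 with rfl | hp0
    · simp
    rcases eq_or_ne r 0 with rfl | hr0
    · simp
    rw [SetLike.mem_coe, mem_degreeLT] at *
    rw [← natDegree_lt_iff_degree_lt hp0] at hp
    rw [← natDegree_lt_iff_degree_lt hr0] at hr
    rw [← natDegree_lt_iff_degree_lt (mul_ne_zero hp0 hr0), natDegree_mul hp0 hr0]
    omega
  · ext x y
    simp

variable [Fintype V]

theorem IsDistanceRegular.one_mem_polyMatrices [DecidableEq V] (hG : IsDistanceRegular G)
    (hq : ∀ i, 1 ≤ i → q ^ i ≠ 1) : 1 ∈ polyMatrices G q (G.diam + 1) := by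
  set p : ℝ[X] := ∏ i ∈ Finset.Icc 1 G.diam, (X - C (q ^ i)) with hp
  have hdeg : p ∈ degreeLT ℝ (G.diam + 1) := by
    have : p.degree = G.diam := by simp [hp, degree_prod, -map_pow]
    rw [mem_degreeLT, this]
    exact_mod_cast G.diam.lt_succ_self
  have hp1 : p.eval 1 ≠ 0 := by
    rw [hp, eval_prod, Finset.prod_ne_zero_iff]
    intro i hi
    simpa [sub_eq_zero] using (hq i (Finset.mem_Icc.1 hi).1).symm
  have hpi {i : ℕ} (hi : 1 ≤ i) (hi' : i ≤ G.diam) : p.eval (q ^ i) = 0 := by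
    rw [hp, eval_prod]
    exact Finset.prod_eq_zero (Finset.mem_Icc.2 ⟨hi, hi'⟩) (by simp)
  refine ⟨(p.eval 1)⁻¹ • p, Submodule.smul_mem _ _ hdeg, ?_⟩
  ext x y
  rcases eq_or_ne x y with rfl | hxy
  · simp [hp1]
  · simp [hxy, hpi (hG.1.pos_dist_of_ne hxy) (hG.dist_le_diam x y)]

variable [DecidableRel G.Adj] {θ : ℕ → ℝ}

theorem IsDistanceRegular.mul_mem_polyMatrices (hG : IsDistanceRegular G)
    (hA : ∀ n, ∀ M ∈ polyMatrices G q (n + 1),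
      G.adjMatrix ℝ * M - θ n • M ∈ polyMatrices G q n) {n : ℕ} (f : ℕ → ℝ) {N : Matrix V V ℝ}
    (hN : N ∈ polyMatrices G q n) : distMatrix G f * N ∈ polyMatrices G q n := by
  classical
  have hinv : polyMatrices G q n ≤
      (polyMatrices G q n).comap (Algebra.lsmul ℝ ℝ (Matrix V V ℝ) (G.adjMatrix ℝ)) := by
    rcases n with _ | n
    · simp [polyMatrices_zero]
    · intro M hM
      simpa using add_mem (polyMatrices_mono n.le_succ (hA n M hM))
        (Submodule.smul_mem _ (θ n) hM)
  have hf := hG.distMatrix_mem_adjoin f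
  rw [Algebra.adjoin_singleton_eq_range_aeval] at hf
  obtain ⟨p, hp⟩ := hf
  rw [← hp]
  exact aeval_apply_smul_mem_of_le_comap' hN p _ hinv

theorem IsDistanceRegular.diagonal_mem_columnSpan [DecidableEq V] (hG : IsDistanceRegular G)
    (hA : ∀ n, ∀ M ∈ polyMatrices G q (n + 1),
      G.adjMatrix ℝ * M - θ n • M ∈ polyMatrices G q n) {m n : ℕ} {N : Matrix V V ℝ}
    (hN : N ∈ polyMatrices G q (n + 1)) (y : V) {v : EuclideanSpace ℝ V}
    (hv : v ∈ columnSpan (polyMatrices G q m)) :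
    Matrix.toLpLinAlgEquiv 2 (Matrix.diagonal (N.row y)) v ∈
      columnSpan (polyMatrices G q (m + n)) := by
  have hsq {l : ℕ} {M : Matrix V V ℝ} (hM : M ∈ polyMatrices G q l) :
      M * M ∈ polyMatrices G q l := by
    obtain ⟨p, -, hp⟩ := id hM
    have := hG.mul_mem_polyMatrices hA (fun h => p.eval (q ^ h)) hM
    rwa [show distMatrix G (fun h => p.eval (q ^ h)) = M from hp] at this
  suffices columnSpan (polyMatrices G q m) ≤ (columnSpan (polyMatrices G q (m + n))).comap
      (Matrix.toLpLinAlgEquiv 2 (Matrix.diagonal (N.row y))) from this hv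
  refine columnSpan_le fun M hM z => ?_
  have hprod : (M * Mᵀ) ⊙ (Nᵀ * N) ∈ polyMatrices G q (m + n) := by
    rw [transpose_of_mem_polyMatrices hM, transpose_of_mem_polyMatrices hN]
    exact hadamard_mem_polyMatrices (hsq hM) (hsq hN)
  have hdiag : Matrix.toLpLinAlgEquiv 2 (Matrix.diagonal (N.row y)) (WithLp.toLp 2 (M.col z)) =
      WithLp.toLp 2 (N.row y * M.col z) := by
    ext w
    simp [Matrix.toLpLinAlgEquiv, Matrix.toLpLin_apply, Matrix.mulVec_diagonal]
  rw [Submodule.mem_comap, hdiag]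
  exact toLp_row_mul_col_mem (toLp_col_mem_columnSpan hprod) y z

end PolyMatrix

section Classical

theorem bracket_eq {b : ℝ} (hb : b ≠ 1) (j : ℕ) : bracket b j = (b ^ j - 1) * (b - 1)⁻¹ := by
  rw [bracket, geom_sum_eq hb, div_eq_mul_inv]

variable {V : Type*} [Fintype V] {G : SimpleGraph V} {D : ℕ} {b α β : ℝ}

theorem HasClassicalParameters.exists_quadratic (hcl : HasClassicalParameters G D b α β)
    (hb0 : b ≠ 0) (hb1 : b ≠ 1) : ∃ c₀ c₁ b₀ b₁ δ : ℝ, ∀ h ≤ D,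
      (cNum G h : ℝ) = c₀ + c₁ * b ^ h + b⁻¹ * δ * (b ^ h) ^ 2 ∧
      (bNum G h : ℝ) = b₀ + b₁ * b ^ h + δ * (b ^ h) ^ 2 := by
  obtain ⟨hD, hc, hbn⟩ := hcl
  set g := (b - 1)⁻¹ with hg
  refine ⟨-g * (1 - α * g), g * (1 - α * g) - α * g ^ 2 * b⁻¹, (bracket b D + g) * (β + α * g),
    -g * (β + α * g + α * (bracket b D + g)), α * g ^ 2, fun h hh => ⟨?_, ?_⟩⟩
  · rcases h with _ | i
    · simp only [cNum, Nat.cast_zero, pow_zero]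
      ring
    · rw [hc _ i.succ_pos hh, bracket_eq hb1, bracket_eq hb1, Nat.succ_eq_add_one,
        Nat.add_sub_cancel, ← hg, pow_succ]
      field_simp
      ring
  · rcases hh.eq_or_lt with rfl | hlt
    · rw [bNum, if_neg (by omega), bracket_eq hb1, ← hg]
      push_cast
      ring
    · rw [hbn _ hlt, bracket_eq hb1 h, ← hg]
      ring

variable [DecidableRel G.Adj]

theorem IsDistanceRegular.adjMatrix_mul_polyMatrix_X_pow_apply (hG : IsDistanceRegular G)
    (hb : b ≠ 0) (n : ℕ) (x z : V) :
    (G.adjMatrix ℝ * polyMatrix G b⁻¹ (X ^ n)) x z = (bNum G 0 + cNum G (G.dist x z) * (b ^ n - 1) +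
      bNum G (G.dist x z) * (b⁻¹ ^ n - 1)) * (b⁻¹ ^ G.dist x z) ^ n := by
  have hA : (G.adjMatrix ℝ * polyMatrix G b⁻¹ (X ^ n)) x z = _ :=
    congrFun (congrFun (hG.adjMatrix_mul_distMatrix fun h => (X ^ n : ℝ[X]).eval (b⁻¹ ^ h)) x) z
  have hcloser : (cNum G (G.dist x z) : ℝ) * (b⁻¹ ^ (G.dist x z - 1)) ^ n =
      cNum G (G.dist x z) * ((b⁻¹ ^ G.dist x z) ^ n * b ^ n) := by
    rcases G.dist x z with _ | i
    · simp [cNum]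
    · rw [Nat.add_sub_cancel, pow_succ, mul_pow, mul_assoc, ← mul_pow b⁻¹, inv_mul_cancel₀ hb,
        one_pow, mul_one]
  rw [hA]
  simp only [distMatrix_apply, eval_pow, eval_X]
  rw [hcloser, pow_succ b⁻¹ (G.dist x z), mul_pow]
  ring

theorem IsDistanceRegular.adjMatrix_mul_polyMatrix_X_pow (hG : IsDistanceRegular G)
    (hb : b ≠ 0) {c₀ c₁ b₀ b₁ δ : ℝ}
    (hq : ∀ h ≤ G.diam, (cNum G h : ℝ) = c₀ + c₁ * b ^ h + b⁻¹ * δ * (b ^ h) ^ 2 ∧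
      (bNum G h : ℝ) = b₀ + b₁ * b ^ h + δ * (b ^ h) ^ 2) (n : ℕ) :
    G.adjMatrix ℝ * polyMatrix G b⁻¹ (X ^ n) -
        (bNum G 0 + c₀ * (b ^ n - 1) + b₀ * (b⁻¹ ^ n - 1)) • polyMatrix G b⁻¹ (X ^ n) ∈
      polyMatrices G b⁻¹ n := by
  set μ := c₁ * (b ^ n - 1) + b₁ * (b⁻¹ ^ n - 1) with hμ
  set ν := b⁻¹ * δ * (b ^ n - 1) + δ * (b⁻¹ ^ n - 1) with hν
  have hentry (x z : V) : (G.adjMatrix ℝ * polyMatrix G b⁻¹ (X ^ n) -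
      (bNum G 0 + c₀ * (b ^ n - 1) + b₀ * (b⁻¹ ^ n - 1)) • polyMatrix G b⁻¹ (X ^ n)) x z =
        (b⁻¹ ^ G.dist x z) ^ n * (μ * b ^ G.dist x z + ν * (b ^ G.dist x z) ^ 2) := by
    obtain ⟨hc, hb'⟩ := hq _ (hG.dist_le_diam x z)
    rw [Matrix.sub_apply, Matrix.smul_apply, hG.adjMatrix_mul_polyMatrix_X_pow_apply hb, hc, hb']
    simp only [polyMatrix_apply, eval_pow, eval_X, smul_eq_mul]
    ring
  have hinv (h : ℕ) : b⁻¹ ^ h * b ^ h = 1 := by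
    rw [← mul_pow, inv_mul_cancel₀ hb, one_pow]
  -- Multiplying by `b ^ h` lowers the degree in `b⁻¹ ^ h`; for `n ≤ 1` the terms which would have
  -- negative degree have the coefficient `0`.
  rcases n with _ | _ | n
  · refine ⟨0, zero_mem _, ?_⟩
    ext x z
    rw [hentry]
    simp [hμ, hν]
  · have hν0 : ν = 0 := by
      rw [hν]
      linear_combination δ * inv_mul_cancel₀ hb
    refine ⟨C μ, mem_degreeLT.2 degree_C_lt, ?_⟩
    ext x z
    rw [hentry, hν0, polyMatrix_apply, eval_C]
    linear_combination -μ * hinv (G.dist x z)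
  · refine ⟨C μ * X ^ (n + 1) + C ν * X ^ n, add_mem ?_ ?_, ?_⟩
    · exact mem_degreeLT.2 ((degree_C_mul_X_pow_le _ _).trans_lt (by norm_cast; omega))
    · exact mem_degreeLT.2 ((degree_C_mul_X_pow_le _ _).trans_lt (by norm_cast; omega))
    · ext x z
      rw [hentry]
      simp only [polyMatrix_apply, eval_add, eval_mul, eval_C, eval_pow, eval_X]
      linear_combination -(μ * (b⁻¹ ^ G.dist x z) ^ (n + 1) +
        ν * (b⁻¹ ^ G.dist x z) ^ n * (b⁻¹ ^ G.dist x z * b ^ G.dist x z + 1)) * hinv (G.dist x z)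

theorem IsDistanceRegular.exists_adjMatrix_mul_sub_smul_mem (hG : IsDistanceRegular G)
    (hcl : HasClassicalParameters G G.diam b α β) (hb0 : b ≠ 0) (hb1 : b ≠ 1) :
    ∃ (θ : ℕ → ℝ) (e c d : ℝ), (∀ n, θ n = e + c * b ^ n + d * b⁻¹ ^ n) ∧
      ∀ n, ∀ M ∈ polyMatrices G b⁻¹ (n + 1),
        G.adjMatrix ℝ * M - θ n • M ∈ polyMatrices G b⁻¹ n := by
  obtain ⟨c₀, c₁, b₀, b₁, δ, hq⟩ := hcl.exists_quadratic hb0 hb1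
  have hX := hG.adjMatrix_mul_polyMatrix_X_pow hb0 hq
  refine ⟨fun n => bNum G 0 + c₀ * (b ^ n - 1) + b₀ * (b⁻¹ ^ n - 1), bNum G 0 - c₀ - b₀, c₀, b₀,
    fun n => by ring, fun n => ?_⟩
  rintro _ ⟨p, hp, rfl⟩
  rw [SetLike.mem_coe, degreeLT_eq_span_X_pow] at hp
  induction hp using Submodule.span_induction with
  | zero => simp
  | add p r _ _ hp hr => simpa [mul_add, add_sub_add_comm] using add_mem hp hr
  | smul t p _ hp => simpa [smul_sub, smul_comm t] using Submodule.smul_mem _ t hp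
  | mem p hp =>
    obtain ⟨i, hi, rfl⟩ := Finset.mem_image.1 hp
    rcases (Finset.mem_range_succ_iff.1 hi).eq_or_lt with rfl | hlt
    · exact hX i
    · have hXi : polyMatrix G b⁻¹ (X ^ i) ∈ polyMatrices G b⁻¹ n :=
        ⟨X ^ i, mem_degreeLT.2 ((degree_X_pow_le i).trans_lt (by exact_mod_cast hlt)), rfl⟩
      have := sub_mem (add_mem (polyMatrices_mono hlt.le (hX i)) (Submodule.smul_mem _
        (bNum G 0 + c₀ * (b ^ i - 1) + b₀ * (b⁻¹ ^ i - 1)) hXi)) (Submodule.smul_mem _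
        (bNum G 0 + c₀ * (b ^ n - 1) + b₀ * (b⁻¹ ^ n - 1)) hXi)
      rwa [sub_add_cancel] at this

theorem pow_ne_one_of_abs_ne_one (hb : |b| ≠ 1) {i : ℕ} (hi : 1 ≤ i) : b ^ i ≠ 1 := by
  intro h
  exact hb ((abs_pow_eq_one b (Nat.one_le_iff_ne_zero.1 hi)).1 (by rw [h, abs_one]))

theorem IsDistanceRegular.exists_commute_tridiagonal [DecidableEq V] (hG : IsDistanceRegular G)
    (hcl : HasClassicalParameters G G.diam b α β) (hb0 : b ≠ 0) (hb : |b| ≠ 1) (y : V)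
    {A S : Matrix V V ℝ} (hA : A = G.adjMatrix ℝ)
    (hS : S = Matrix.diagonal fun w => b⁻¹ ^ G.dist y w) : ∃ γ ρ : ℝ,
      Commute A (A * A * S - (b + b⁻¹) • (A * S * A) + S * A * A
        - γ • (A * S + S * A) - ρ • S) := by
  obtain ⟨θ, e, c, d, hθ, hstep⟩ :=
    hG.exists_adjMatrix_mul_sub_smul_mem hcl hb0 fun h => hb (by rw [h, abs_one])
  have hX : polyMatrix G b⁻¹ X ∈ polyMatrices G b⁻¹ (1 + 1) :=
    ⟨X, mem_degreeLT.2 (degree_X_le.trans_lt (by norm_num)), rfl⟩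
  have hSX : S = Matrix.diagonal ((polyMatrix G b⁻¹ X).row y) := by
    rw [hS]
    congr 1
    ext w
    simp
  have hsymm {M : Matrix V V ℝ} (hM : Mᵀ = M) :
      (Matrix.toLpLinAlgEquiv 2 M : Module.End ℝ (EuclideanSpace ℝ V)).IsSymmetric :=
    Matrix.isSymmetric_toEuclideanLin_iff.2 hM
  have hone : 1 ∈ polyMatrices G b⁻¹ (G.diam + 1) := hG.one_mem_polyMatrices fun i hi => by
    simpa using pow_ne_one_of_abs_ne_one hb hi
  have hcomm := commute_tridiagonal (T := Matrix.toLpLinAlgEquiv 2 A)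
    (S := Matrix.toLpLinAlgEquiv 2 S) (W := fun n => columnSpan (polyMatrices G b⁻¹ n))
    (hsymm (by rw [hA, SimpleGraph.transpose_adjMatrix]))
    (hsymm (by rw [hS, Matrix.diagonal_transpose]))
    (fun _ _ h => columnSpan_mono (polyMatrices_mono h))
    (by simp only [polyMatrices_zero, columnSpan_bot]) (columnSpan_eq_top hone)
    (fun n _ hv => toLpLin_sub_smul_mem_columnSpan (hA ▸ hstep n) hv)
    (fun n _ hv => hSX ▸ hG.diagonal_mem_columnSpan hstep hX y hv)
    (geometric_three_term hb0 e c d hθ)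
  refine ⟨e * (2 - (b + b⁻¹)), c * d * (4 - (b + b⁻¹) ^ 2) - e ^ 2 * (2 - (b + b⁻¹)),
    (Matrix.toLpLinAlgEquiv (R := ℝ) (n := V) 2).injective ?_⟩
  simpa only [map_sub, map_add, map_mul, map_smul] using hcomm.eq

end Classical

section Kites

variable {V : Type*} [Fintype V] {G : SimpleGraph V} {b α β : ℝ}

theorem IsDistanceRegular.sum_closer_eq_of_closer [DecidableRel G.Adj] {R : Type*} [CommRing R]
    (hG : IsDistanceRegular G) {h : ℕ} {u v z : V} (huv : G.Adj u v)
    (huz : G.dist u z = h + 1) (hvz : G.dist v z = h) (f : ℕ → R) :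
    ∑ w ∈ G.neighborFinset u with G.dist w z = h, f (G.dist v w) =
      f 0 + #{w ∈ G.neighborFinset u | G.dist w z = h ∧ G.Adj v w} * f 1 +
        (cNum G (h + 1) - 1 - #{w ∈ G.neighborFinset u | G.dist w z = h ∧ G.Adj v w}) * f 2 := by
  classical
  have hcard : #{w ∈ G.neighborFinset u | G.dist w z = h} = cNum G (h + 1) := by
    simpa only [huz, Nat.add_right_cancel_iff] using hG.card_neighbor_closer u z
  have hv : v ∈ {w ∈ G.neighborFinset u | G.dist w z = h} := by simp [huv, hvz]
  have hpt : ∀ w ∈ {w ∈ G.neighborFinset u | G.dist w z = h}, f (G.dist v w) =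
      f 2 + ((if v = w then f 0 - f 2 else 0) + if G.Adj v w then f 1 - f 2 else 0) := by
    intro w hw
    simp only [mem_filter, SimpleGraph.mem_neighborFinset] at hw
    rcases eq_or_ne v w with rfl | hvw
    · simp
    · have hpos := hG.1.pos_dist_of_ne hvw
      have hcases := dist_eq_or_of_adj hG.1 huv w
      rw [SimpleGraph.dist_eq_one_iff_adj.2 hw.1] at hcases
      rcases (by omega : G.dist v w = 1 ∨ G.dist v w = 2) with hd | hd <;>
        simp [hd, hvw, ← SimpleGraph.dist_eq_one_iff_adj]
  rw [sum_congr rfl hpt, sum_add_distrib, sum_add_distrib, sum_ite_eq, if_pos hv, ← sum_filter,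
    filter_filter, sum_const, sum_const, hcard]
  simp only [nsmul_eq_mul]
  ring

theorem IsDistanceRegular.sum_farther_eq_of_closer [DecidableRel G.Adj] {R : Type*} [CommRing R]
    (hG : IsDistanceRegular G) {h : ℕ} {u v z : V} (huv : G.Adj u v)
    (huz : G.dist u z = h + 2) (hvz : G.dist v z = h + 1) (f : ℕ → R) :
    ∑ w ∈ G.neighborFinset z with G.dist w u = h + 1, f (G.dist v w) =
      cNum G (h + 1) * f h +
        #{w ∈ G.neighborFinset z | G.dist w u = h + 1 ∧ G.dist v w = h + 1} * f (h + 1) +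
        (cNum G (h + 2) - cNum G (h + 1) -
          #{w ∈ G.neighborFinset z | G.dist w u = h + 1 ∧ G.dist v w = h + 1}) * f (h + 2) := by
  have hzu : G.dist z u = h + 2 := SimpleGraph.dist_comm.trans huz
  have hzv : G.dist z v = h + 1 := SimpleGraph.dist_comm.trans hvz
  have hcard : #{w ∈ G.neighborFinset z | G.dist w u = h + 1} = cNum G (h + 2) := by
    rw [← hzu, ← hG.card_neighbor_closer z u, hzu]
    simp only [Nat.add_right_cancel_iff]
  have hcard' : #{w ∈ G.neighborFinset z | G.dist w u = h + 1 ∧ G.dist v w = h} =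
      cNum G (h + 1) := by
    rw [← hzv, ← hG.card_neighbor_closer z v, hzv]
    congr 1
    refine filter_congr fun w hw => ?_
    have hzw := dist_eq_or_of_adj hG.1 ((G.mem_neighborFinset z w).1 hw) u
    have huw := dist_eq_or_of_adj hG.1 huv w
    rw [SimpleGraph.dist_comm (u := w) (v := v), SimpleGraph.dist_comm (u := w) (v := u)] at *
    omega
  have hpt : ∀ w ∈ {w ∈ G.neighborFinset z | G.dist w u = h + 1}, f (G.dist v w) =
      f (h + 2) + ((if G.dist v w = h then f h - f (h + 2) else 0) +
        if G.dist v w = h + 1 then f (h + 1) - f (h + 2) else 0) := by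
    intro w hw
    have hcases := dist_eq_or_of_adj hG.1 ((G.mem_neighborFinset z w).1 (mem_filter.1 hw).1) v
    rw [hzv, SimpleGraph.dist_comm (u := w)] at hcases
    rcases hcases with hd | hd | hd
    · simp [Nat.add_right_cancel hd]
    all_goals simp [hd, Nat.add_assoc]
  rw [sum_congr rfl hpt, sum_add_distrib, sum_add_distrib, ← sum_filter, ← sum_filter,
    filter_filter, filter_filter, sum_const, sum_const, sum_const, hcard, hcard']
  simp only [nsmul_eq_mul]
  ring

section AdjMatrix

variable [DecidableRel G.Adj]

theorem IsDistanceRegular.adjMatrix_mul_self_apply (hG : IsDistanceRegular G) {x z : V}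
    (h : 2 ≤ G.dist x z) :
    (G.adjMatrix ℝ * G.adjMatrix ℝ) x z = if G.dist x z = 2 then (cNum G 2 : ℝ) else 0 := by
  nth_rw 2 [adjMatrix_eq_distMatrix]
  rw [hG.adjMatrix_mul_distMatrix, distMatrix_apply]
  have hne : G.dist x z + 1 ≠ 1 ∧ G.dist x z ≠ 1 ∧ (G.dist x z - 1 = 1 ↔ G.dist x z = 2) := by
    omega
  simp only [Pi.single_apply, hne, if_false, mul_zero, add_zero, mul_ite, mul_one]
  split_ifs with h2 <;> simp [h2]

theorem IsDistanceRegular.adjMatrix_sq_mul_diagonal_mul_adjMatrix_apply [DecidableEq V]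
    (hG : IsDistanceRegular G) {u z : V} (huz : G.dist u z = 3) (s : V → ℝ) :
    (G.adjMatrix ℝ * G.adjMatrix ℝ * Matrix.diagonal s * G.adjMatrix ℝ) u z =
      cNum G 2 * ∑ w ∈ G.neighborFinset z with G.dist w u = 2, s w := by
  rw [SimpleGraph.mul_adjMatrix_apply, mul_sum, sum_filter]
  refine sum_congr rfl fun w hw => ?_
  have hzw := dist_eq_or_of_adj hG.1 ((G.mem_neighborFinset z w).1 hw) u
  rw [SimpleGraph.dist_comm (u := w), SimpleGraph.dist_comm (u := z), huz] at hzw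
  rw [Matrix.mul_diagonal, hG.adjMatrix_mul_self_apply (by omega), ite_mul, zero_mul,
    SimpleGraph.dist_comm (u := w)]

theorem IsDistanceRegular.adjMatrix_cube_apply (hG : IsDistanceRegular G) {u z : V}
    (huz : G.dist u z = 3) :
    (G.adjMatrix ℝ * G.adjMatrix ℝ * G.adjMatrix ℝ) u z = cNum G 2 * cNum G 3 := by
  classical
  have hcard := hG.card_neighbor_closer z u
  rw [SimpleGraph.dist_comm, huz] at hcard
  simpa [← hcard] using hG.adjMatrix_sq_mul_diagonal_mul_adjMatrix_apply huz 1

theorem IsDistanceRegular.balanced (hG : IsDistanceRegular G)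
    (hcl : HasClassicalParameters G G.diam b α β) (hb0 : b ≠ 0) (hb : |b| ≠ 1) (y : V) {u z : V}
    (huz : G.dist u z = 3) :
    (b + b⁻¹ + 1) * (∑ w ∈ G.neighborFinset u with G.dist w z = 2, b⁻¹ ^ G.dist y w -
      ∑ w ∈ G.neighborFinset z with G.dist w u = 2, b⁻¹ ^ G.dist y w) =
      cNum G 3 * (b⁻¹ ^ G.dist y u - b⁻¹ ^ G.dist y z) := by
  classical
  set A := G.adjMatrix ℝ with hA
  set s : V → ℝ := fun w => b⁻¹ ^ G.dist y w
  have hzu : G.dist z u = 3 := SimpleGraph.dist_comm.trans huz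
  obtain ⟨γ, ρ, hcomm⟩ := hG.exists_commute_tridiagonal hcl hb0 hb y hA (S := .diagonal s) rfl
  have hone : A u z = 0 := by simp [hA, ← SimpleGraph.dist_eq_one_iff_adj, huz]
  have hsq : (A * A) u z = 0 := by
    rw [hG.adjMatrix_mul_self_apply (by omega), if_neg (by omega)]
  have hcube : (A * A * A) u z = cNum G 2 * cNum G 3 := hG.adjMatrix_cube_apply huz
  have hleft : (A * A * Matrix.diagonal s * A) u z =
      cNum G 2 * ∑ w ∈ G.neighborFinset z with G.dist w u = 2, s w :=
    hG.adjMatrix_sq_mul_diagonal_mul_adjMatrix_apply huz s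
  have htranspose : (A * A * Matrix.diagonal s * A)ᵀ = A * Matrix.diagonal s * A * A := by
    simp only [Matrix.transpose_mul, Matrix.diagonal_transpose, SimpleGraph.transpose_adjMatrix,
      mul_assoc, hA]
  have hright : (A * Matrix.diagonal s * A * A) u z =
      cNum G 2 * ∑ w ∈ G.neighborFinset u with G.dist w z = 2, s w := by
    rw [← htranspose]
    exact hG.adjMatrix_sq_mul_diagonal_mul_adjMatrix_apply hzu s
  have hc : (cNum G 2 : ℝ) ≠ 0 := by
    have := hG.dist_le_diam u z
    exact_mod_cast hG.cNum_ne_zero (by omega) (by omega)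
  have hentry := congrFun₂ hcomm.eq u z
  simp only [mul_sub, mul_add, sub_mul, add_mul, mul_smul_comm, smul_mul_assoc,
    ← mul_assoc] at hentry
  simp only [Matrix.sub_apply, Matrix.add_apply, Matrix.smul_apply, smul_eq_mul, hleft, hright,
    mul_assoc (Matrix.diagonal s), Matrix.diagonal_mul, Matrix.mul_diagonal, hcube, hsq,
    hone] at hentry
  apply mul_left_cancel₀ hc
  linear_combination hentry

end AdjMatrix

theorem IsDistanceRegular.mul_card_eq_card (hG : IsDistanceRegular G) [DecidableRel G.Adj]
    (hcl : HasClassicalParameters G G.diam b α β) (hb0 : b ≠ 0) (hb : |b| ≠ 1) {u v z : V}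
    (huv : G.Adj u v) (huz : G.dist u z = 3) (hvz : G.dist v z = 2) :
    b * #{w ∈ G.neighborFinset u | G.dist w z = 2 ∧ G.Adj v w} =
      #{w ∈ G.neighborFinset z | G.dist w u = 2 ∧ G.dist v w = 2} := by
  classical
  have hD : 3 ≤ G.diam := huz ▸ hG.dist_le_diam u z
  have hbal := hG.balanced hcl hb0 hb v huz
  rw [hG.sum_closer_eq_of_closer huv huz hvz, hG.sum_farther_eq_of_closer huv huz hvz,
    hcl.2.1 2 (by omega) (by omega), hcl.2.1 3 (by omega) hD, hvz,
    SimpleGraph.dist_eq_one_iff_adj.2 huv.symm] at hbal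
  simp only [bracket, sum_range_succ, sum_range_zero, Nat.reduceAdd] at hbal
  generalize #{w ∈ G.neighborFinset u | G.dist w z = 2 ∧ G.Adj v w} = m at hbal ⊢
  generalize #{w ∈ G.neighborFinset z | G.dist w u = 2 ∧ G.dist v w = 2} = t at hbal ⊢
  have hfactor : (b - 1) * (b ^ 2 + b + 1) * (b * m - t) = 0 := by
    field_simp at hbal
    linear_combination hbal
  have hb1 : b - 1 ≠ 0 := sub_ne_zero.2 fun h => hb (by rw [h, abs_one])
  have hb2 : b ^ 2 + b + 1 ≠ 0 := by nlinarith
  exact sub_eq_zero.1 ((mul_eq_zero.1 hfactor).resolve_left (mul_ne_zero hb1 hb2))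

theorem IsDistanceRegular.not_isKite_three (hG : IsDistanceRegular G)
    (hcl : HasClassicalParameters G G.diam b α β) (hb : b < 0) (hb1 : b ≠ -1) (u v w z : V) :
    ¬ IsKite G 3 u v w z := by
  classical
  rintro ⟨huv, huw, hvw, huz, hvz, hwz⟩
  have hmem : w ∈ {w ∈ G.neighborFinset u | G.dist w z = 2 ∧ G.Adj v w} := by
    simp [huw, hwz, hvw]
  have hpos : (0 : ℝ) < #{w ∈ G.neighborFinset u | G.dist w z = 2 ∧ G.Adj v w} := by
    exact_mod_cast card_pos.2 ⟨w, hmem⟩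
  have habs : |b| ≠ 1 := by
    rw [abs_of_neg hb]
    exact fun h => hb1 (neg_eq_iff_eq_neg.1 h)
  have hlt := mul_neg_of_neg_of_pos hb hpos
  rw [hG.mul_card_eq_card hcl hb.ne habs huv huz hvz] at hlt
  exact absurd hlt (Nat.cast_nonneg _).not_gt

theorem IsDistanceRegular.exists_isKite_succ (hG : IsDistanceRegular G) {i : ℕ} (hi1 : 1 ≤ i)
    (hi : i < G.diam) {u v w z : V} (h : IsKite G i u v w z) : ∃ y, IsKite G (i + 1) u v w y := by
  obtain ⟨huv, huw, hvw, huz, hvz, hwz⟩ := h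
  obtain ⟨y, hzy, hyu⟩ := hG.exists_farther_neighbor (x := z) (z := u)
    (by rw [SimpleGraph.dist_comm]; omega)
  rw [SimpleGraph.dist_comm (u := y), SimpleGraph.dist_comm (u := z), huz] at hyu
  have hdist : ∀ p, G.Adj u p → G.dist p z = i - 1 → G.dist p y = i := by
    intro p hup hpz
    have hpu := dist_eq_or_of_adj hG.1 hup y
    have hzp := dist_eq_or_of_adj hG.1 hzy p
    rw [SimpleGraph.dist_comm (u := y), SimpleGraph.dist_comm (u := z)] at hzp
    omega
  exact ⟨y, huv, huw, hvw, hyu, hdist v huv hvz, hdist w huw hwz⟩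

theorem IsDistanceRegular.not_isKite_two (hG : IsDistanceRegular G)
    (hcl : HasClassicalParameters G G.diam b α β) (hD : 3 ≤ G.diam) (hb : b < 0) (hb1 : b ≠ -1)
    (u v w z : V) : ¬ IsKite G 2 u v w z := fun h =>
  let ⟨y, hy⟩ := hG.exists_isKite_succ one_le_two (by omega) h
  hG.not_isKite_three hcl hb hb1 u v w y hy

end Kites

section ClusterGraph

/-- A cluster graph, i.e. a disjoint union of cliques, encoded by the absence of induced paths on
three vertices. -/
def IsClusterGraph {W : Type*} (H : SimpleGraph W) : Prop :=
  ∀ ⦃u v w : W⦄, H.Adj u v → H.Adj v w → u ≠ w → H.Adj u w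

variable {W : Type*} {H : SimpleGraph W}

theorem IsClusterGraph.reachable_iff (hH : IsClusterGraph H) {u v : W} :
    H.Reachable u v ↔ u = v ∨ H.Adj u v := by
  refine ⟨fun h => ?_, ?_⟩
  · rw [SimpleGraph.reachable_iff_reflTransGen] at h
    induction h with
    | refl => exact .inl rfl
    | @tail w v _ hwv ih =>
      rcases ih with rfl | huw
      · exact .inr hwv
      · exact or_iff_not_imp_left.2 (hH huw hwv)
  · rintro (rfl | huv)
    · exact .rfl
    · exact huv.reachable

variable [Fintype W] [DecidableEq W] [DecidableRel H.Adj] {a : ℕ}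

theorem IsClusterGraph.exists_isDisjointUnionOfCliques (hH : IsClusterGraph H)
    (hreg : H.IsRegularOfDegree a) :
    ∃ m, m * (a + 1) = Fintype.card W ∧ IsDisjointUnionOfCliques H m (a + 1) := by
  classical
  set P := Finpartition.ofSetoid H.reachableSetoid
  have hmem {y z : W} : z ∈ P.part y ↔ y = z ∨ H.Adj y z :=
    Finpartition.mem_part_ofSetoid_iff_rel.trans hH.reachable_iff
  have hpart (y : W) : P.part y = insert y (H.neighborFinset y) := by
    ext z
    rw [hmem, mem_insert, SimpleGraph.mem_neighborFinset, eq_comm]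
  have hcard : ∀ C ∈ P.parts, #C = a + 1 := by
    intro C hC
    obtain ⟨y, hy⟩ := P.nonempty_of_mem_parts hC
    rw [← P.part_eq_of_mem hC hy, hpart, card_insert_of_notMem (H.notMem_neighborFinset_self y),
      SimpleGraph.card_neighborFinset_eq_degree, hreg.degree_eq]
  refine ⟨#P.parts, ?_, P, rfl, hcard, fun y z => ⟨fun hyz => ?_, ?_⟩⟩
  · rw [← card_univ, ← P.sum_card_parts, sum_congr rfl hcard, sum_const, smul_eq_mul]
  · exact ⟨hyz.ne, P.part y, P.part_mem.2 (mem_univ y), hmem.2 (.inl rfl), hmem.2 (.inr hyz)⟩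
  · rintro ⟨hne, C, hC, hy, hz⟩
    rw [← P.part_eq_of_mem hC hy, hmem] at hz
    exact hz.resolve_left hne

/-- Adjacent vertices have the same closed neighbourhood, so adjacent rows of `A + 1` agree. -/
theorem IsClusterGraph.adjMatrix_mul_adjMatrix_add_one {R : Type*} [Ring R]
    (hH : IsClusterGraph H) (hreg : H.IsRegularOfDegree a) :
    H.adjMatrix R * (H.adjMatrix R + 1) = (a : R) • (H.adjMatrix R + 1) := by
  ext y z
  have hrow : ∀ w ∈ H.neighborFinset y, (H.adjMatrix R + 1) w z = (H.adjMatrix R + 1) y z := by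
    intro w hw
    have hyw := (H.mem_neighborFinset y w).1 hw
    rcases eq_or_ne y z with rfl | hyz
    · simp [hyw.symm, hyw.ne']
    · rcases eq_or_ne w z with rfl | hwz
      · simp [hyw, hyz]
      · have hadj : H.Adj w z ↔ H.Adj y z :=
          ⟨fun h => hH hyw h hyz, fun h => hH hyw.symm h hwz⟩
        simp [hadj, hyz, hwz]
  rw [SimpleGraph.adjMatrix_mul_apply, sum_congr rfl hrow, sum_const,
    SimpleGraph.card_neighborFinset_eq_degree, hreg.degree_eq, nsmul_eq_mul, Matrix.smul_apply,
    smul_eq_mul]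

end ClusterGraph

section Spectrum

variable {K M : Type*} [Field K] [AddCommGroup M] [Module K M] {f : Module.End K M} {a c : K}

theorem isProj_eigenspace (hac : a ≠ c) (hf : (f - a • 1) * (f - c • 1) = 0) :
    LinearMap.IsProj (f.eigenspace a) ((a - c)⁻¹ • (f - c • 1)) where
  map_mem v := by
    have hv : f (f v - c • v) - a • (f v - c • v) = 0 := LinearMap.congr_fun hf v
    exact Submodule.smul_mem _ _ (Module.End.mem_eigenspace_iff.2 (sub_eq_zero.1 hv))
  map_id v hv := by
    rw [Module.End.mem_eigenspace_iff] at hv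
    simp [hv, ← sub_smul, smul_smul, inv_mul_cancel₀ (sub_ne_zero.2 hac)]

theorem finrank_eigenspace [FiniteDimensional K M] (hac : a ≠ c)
    (hf : (f - a • 1) * (f - c • 1) = 0) :
    (Module.finrank K (f.eigenspace a) : K) =
      (LinearMap.trace K M f - c * Module.finrank K M) / (a - c) := by
  rw [← (isProj_eigenspace hac hf).trace, map_smul, map_sub, map_smul, LinearMap.trace_one,
    smul_eq_mul, smul_eq_mul, div_eq_inv_mul]

theorem eq_or_eq_of_hasEigenvalue (hf : (f - a • 1) * (f - c • 1) = 0) {θ : K}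
    (hθ : f.HasEigenvalue θ) : θ = a ∨ θ = c := by
  obtain ⟨v, hv⟩ := hθ.exists_hasEigenvector
  have hroot : ((θ - a) * (θ - c)) • v = 0 := by
    have := LinearMap.congr_fun hf v
    simp only [Module.End.mul_apply, LinearMap.sub_apply, LinearMap.smul_apply,
      Module.End.one_apply, map_sub, map_smul, hv.apply_eq_smul, LinearMap.zero_apply] at this
    rw [← this]
    module
  simpa [sub_eq_zero, hv.2] using hroot

theorem hasEigenvalue_of_finrank_cast_ne_zero
    (h : (Module.finrank K (f.eigenspace a) : K) ≠ 0) : f.HasEigenvalue a :=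
  fun hbot => h (by
    change f.eigenspace a = ⊥ at hbot
    rw [hbot, finrank_bot, Nat.cast_zero])

end Spectrum

section ClusterSpectrum

variable {W : Type*} [Fintype W] [DecidableEq W] {H : SimpleGraph W} [DecidableRel H.Adj] {a : ℕ}
  {K : Type*} [Field K]

theorem IsClusterGraph.toLin'_adjMatrix_sub_mul (hH : IsClusterGraph H)
    (hreg : H.IsRegularOfDegree a) :
    ((H.adjMatrix K).toLin' - (a : K) • 1) * ((H.adjMatrix K).toLin' - (-1 : K) • 1) = 0 := by
  have h : (H.adjMatrix K - (a : K) • 1) * (H.adjMatrix K - (-1 : K) • 1) = 0 := by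
    rw [neg_one_smul, sub_neg_eq_add, sub_mul, hH.adjMatrix_mul_adjMatrix_add_one hreg,
      smul_mul_assoc, one_mul, sub_self]
  have hlin := congrArg Matrix.toLinAlgEquiv' h
  simp only [map_mul, map_sub, map_smul, map_one, map_zero] at hlin
  exact hlin

variable [CharZero K]

theorem IsClusterGraph.finrank_eigenspace_degree (hH : IsClusterGraph H)
    (hreg : H.IsRegularOfDegree a) :
    (Module.finrank K (Module.End.eigenspace (H.adjMatrix K).toLin' (a : K)) : K) =
      Fintype.card W / (a + 1) := by
  have hne : (a : K) ≠ -1 := by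
    rw [ne_eq, eq_neg_iff_add_eq_zero]
    exact Nat.cast_add_one_ne_zero a
  simp [finrank_eigenspace hne (hH.toLin'_adjMatrix_sub_mul hreg), Matrix.trace_toLin'_eq]

theorem IsClusterGraph.finrank_eigenspace_neg_one (hH : IsClusterGraph H)
    (hreg : H.IsRegularOfDegree a) :
    (Module.finrank K (Module.End.eigenspace (H.adjMatrix K).toLin' (-1 : K)) : K) =
      Fintype.card W * a / (a + 1) := by
  have hne : (-1 : K) ≠ a := by
    rw [ne_comm, ne_eq, eq_neg_iff_add_eq_zero]
    exact Nat.cast_add_one_ne_zero a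
  have hcomm : Commute ((H.adjMatrix K).toLin' - (a : K) • 1)
      ((H.adjMatrix K).toLin' - (-1 : K) • 1) :=
    ((Commute.refl _).sub_left ((Commute.one_left _).smul_left _)).sub_right
      ((Commute.one_right _).smul_right _)
  have hne' : (a : K) + 1 ≠ 0 := Nat.cast_add_one_ne_zero a
  rw [finrank_eigenspace hne (hcomm.eq.symm.trans (hH.toLin'_adjMatrix_sub_mul hreg)),
    Matrix.trace_toLin'_eq, SimpleGraph.trace_adjMatrix, Module.finrank_fintype_fun_eq_card,
    div_eq_div_iff (sub_ne_zero.2 hne) hne']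
  ring

theorem IsClusterGraph.hasEigenvalue_iff [Nonempty W] (hH : IsClusterGraph H)
    (hreg : H.IsRegularOfDegree a) (ha : a ≠ 0) {θ : K} :
    Module.End.HasEigenvalue (H.adjMatrix K).toLin' θ ↔ θ = a ∨ θ = -1 := by
  have hne : (a : K) + 1 ≠ 0 := Nat.cast_add_one_ne_zero a
  refine ⟨eq_or_eq_of_hasEigenvalue (hH.toLin'_adjMatrix_sub_mul hreg), ?_⟩
  rintro (rfl | rfl) <;> apply hasEigenvalue_of_finrank_cast_ne_zero
  · rw [hH.finrank_eigenspace_degree hreg]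
    simp [hne]
  · rw [hH.finrank_eigenspace_neg_one hreg]
    simp [ha, hne]

end ClusterSpectrum

section LocalGraph

variable {V : Type*} {G : SimpleGraph V}

theorem isClusterGraph_localGraph (hG : G.Connected) (x : V)
    (hkite : ∀ u v w z, ¬ IsKite G 2 u v w z) :
    IsClusterGraph (localGraph G x) := by
  rintro ⟨u, hu⟩ ⟨v, hv⟩ ⟨w, hw⟩ huv hvw hne
  by_contra huw
  simp only [SimpleGraph.comap_adj, Function.Embedding.subtype_apply, ne_eq, Subtype.mk.injEq] at *
  have hdist : G.dist u w = 2 := by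
    have hgt := hG.one_lt_dist_of_ne_of_not_adj hne huw
    have hle := dist_eq_or_of_adj hG hu.symm w
    rw [SimpleGraph.dist_eq_one_iff_adj.2 hw] at hle
    omega
  exact hkite u x v w ⟨hu.symm, huv, hv, hdist, SimpleGraph.dist_eq_one_iff_adj.2 hw,
    SimpleGraph.dist_eq_one_iff_adj.2 hvw⟩

theorem IsDistanceRegular.isRegularOfDegree_localGraph [Fintype V] [DecidableRel G.Adj]
    (hG : IsDistanceRegular G) (x : V) :
    (localGraph G x).IsRegularOfDegree (aNum G 1) := by
  classical
  intro y
  rw [← hG.card_common_neighbor y.2, ← SimpleGraph.card_neighborFinset_eq_degree,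
    ← card_map (Function.Embedding.subtype _)]
  congr 1
  ext w
  simp [and_comm]

end LocalGraph

end DistReg

open DistReg in
theorem corollary4p5_general {V : Type*} [Fintype V] [DecidableEq V] (G : SimpleGraph V)
    [DecidableRel G.Adj] (D : ℕ) (b α β : ℝ) (k : ℕ)
    (hG : IsDistanceRegular G) (hcl : HasClassicalParameters G D b α β) (hD : 3 ≤ D)
    (hk : G.IsRegularOfDegree k) (ha : aNum G 1 ≠ 0) (hb : b < 0) (hb1 : b ≠ -1) (x : V) :
    (∃ m : ℕ, (m : ℚ) = (k : ℚ) / ((aNum G 1 : ℚ) + 1) ∧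
      IsDisjointUnionOfCliques (localGraph G x) m (aNum G 1 + 1)) ∧
    (∀ θ : ℂ, (localAdj G x).HasEigenvalue θ ↔ θ = (aNum G 1 : ℂ) ∨ θ = -1) ∧
    (Module.finrank ℂ ((localAdj G x).eigenspace (aNum G 1 : ℂ)) : ℚ) =
      (k : ℚ) / ((aNum G 1 : ℚ) + 1) ∧
    (Module.finrank ℂ ((localAdj G x).eigenspace (-1)) : ℚ) =
      (k : ℚ) * (aNum G 1 : ℚ) / ((aNum G 1 : ℚ) + 1) := by
  obtain rfl : G.diam = D := hcl.1
  have hcluster : IsClusterGraph (localGraph G x) :=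
    isClusterGraph_localGraph hG.1 x (hG.not_isKite_two hcl hD hb hb1)
  have hreg := hG.isRegularOfDegree_localGraph x
  have hcard : Fintype.card (G.neighborSet x) = k :=
    (G.card_neighborSet_eq_degree x).trans (hk.degree_eq x)
  obtain ⟨w, hw, -⟩ := hG.exists_farther_neighbor (x := x) (z := x)
    (by rw [SimpleGraph.dist_self]; omega)
  have : Nonempty (G.neighborSet x) := ⟨⟨w, hw⟩⟩
  obtain ⟨m, hm, hcliques⟩ := hcluster.exists_isDisjointUnionOfCliques hreg
  refine ⟨⟨m, ?_, hcliques⟩, fun _ => hcluster.hasEigenvalue_iff hreg ha, ?_, ?_⟩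
  · rw [eq_div_iff (by positivity), ← hcard, ← hm]
    push_cast
    rfl
  · apply Rat.cast_injective (α := ℂ)
    push_cast
    exact hcard ▸ hcluster.finrank_eigenspace_degree hreg
  · apply Rat.cast_injective (α := ℂ)
    push_cast
    exact hcard ▸ hcluster.finrank_eigenspace_neg_one hreg

theorem corollary4p5 {V : Type*} [Fintype V] [DecidableEq V] (G : SimpleGraph V)
    [DecidableRel G.Adj] (D : ℕ) (b α β : ℝ) (k : ℕ)
    (hG : DistReg.IsDistanceRegular G)
    (hcl : DistReg.HasClassicalParameters G D b α β) (hD : 3 ≤ D)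
    (hk : G.IsRegularOfDegree k) (ha : DistReg.aNum G 1 ≠ 0)
    (hneg : b < -1) (hnear : ¬ DistReg.IsNearPolygon G) (x : V) :
    (∃ m : ℕ, (m : ℚ) = (k : ℚ) / ((DistReg.aNum G 1 : ℚ) + 1) ∧
      DistReg.IsDisjointUnionOfCliques (DistReg.localGraph G x) m (DistReg.aNum G 1 + 1)) ∧
    (∀ θ : ℂ, (DistReg.localAdj G x).HasEigenvalue θ ↔
      θ = (DistReg.aNum G 1 : ℂ) ∨ θ = -1) ∧
    (Module.finrank ℂ ((DistReg.localAdj G x).eigenspace (DistReg.aNum G 1 : ℂ)) : ℚ) =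
      (k : ℚ) / ((DistReg.aNum G 1 : ℚ) + 1) ∧
    (Module.finrank ℂ ((DistReg.localAdj G x).eigenspace (-1)) : ℚ) =
      (k : ℚ) * (DistReg.aNum G 1 : ℚ) / ((DistReg.aNum G 1 : ℚ) + 1) := by
  exact corollary4p5_general G D b α β k hG hcl hD hk ha (by linarith) (by linarith) x
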